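/- Let $\mathbb{R}_{\max}=\mathbb{R}\cup\{-\infty\}$ be the max-plus semiring, with addition $a\oplus b=\max(a,b)$ and multiplication $ab=a+b$ (the usual sum), let $n\in\mathbb{N}$, and let $\mathbb{R}_{\max}^n$ and $(\mathbb{R}_{\max}^n)^2$ carry the coordinatewise semimodule structure. Let $\mathcal{W}\subset(\mathbb{R}_{\max}^n)^2$ be a congruence on $\mathbb{R}_{\max}^n$, that is, an equivalence relation on $\mathbb{R}_{\max}^n$ which is also a subsemimodule of $(\mathbb{R}_{\max}^n)^2$ (it is stable under all combinations $\lambda u\oplus\mu v$ with $\lambda,\mu\in\mathbb{R}_{\max}$). Then the following are equivalent: (a) there are $p\in\mathbb{N}$ and a matrix $E\in\mathbb{R}_{\max}^{p\times n}$ such that $\mathcal{W}=\ker E:=\{(x,y)\in(\mathbb{R}_{\max}^n)^2 : Ex=Ey\}$, where $(Ex)_i=\bigoplus_{k} E_{ik}x_k$; (b) $\mathcal{W}$ is finitely generated as a subsemimodule of $(\mathbb{R}_{\max}^n)^2$: there is a finite family $(x_i,y_i)_{i\in I}$ of elements of $(\mathbb{R}_{\max}^n)^2$ such that $\mathcal{W}$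 is the set of all $\bigoplus_{i\in I}\lambda_i(x_i,y_i)$ with $\lambda_i\in\mathbb{R}_{\max}$. -/

import Mathlib

/-- The max-plus semiring `ℝ ∪ {-∞}`. Mathlib's `Tropical R` has the `min` of `R` as its addition
and the `+` of `R` as its multiplication. Here `R` is `ℝ` with its order reversed and with a top
element adjoined: its `min` is the usual `max`, and its top element is `-∞`. -/
abbrev RMax : Type := Tropical (WithTop ℝᵒᵈ)

namespace RMax

/-- The identification of `ℝ ∪ {-∞}` with the elements of the max-plus semiring. -/
def of : WithBot ℝ ≃ RMax := WithBot.toDual.trans Tropical.tropEquiv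

/-- The addition is the maximum. -/
theorem of_add_of (a b : WithBot ℝ) : of a + of b = of (max a b) := by
  induction a <;> induction b <;> rfl

/-- The multiplication is the usual addition. -/
theorem of_mul_of (a b : WithBot ℝ) : of a * of b = of (a + b) := by
  induction a <;> induction b <;> rfl

/-- The zero is `-∞`. -/
theorem zero_eq : (0 : RMax) = of ⊥ := rfl

/-- The unit is the real number `0`. -/
theorem one_eq : (1 : RMax) = of ((0 : ℝ) : WithBot ℝ) := rfl

/-- A congruence on `RMax ^ n`: a subsemimodule of `(RMax ^ n)²` which, as a set of pairs, is an
equivalence relation. -/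
def IsCongruence {n : ℕ} (W : Submodule RMax ((Fin n → RMax) × (Fin n → RMax))) : Prop :=
  Equivalence fun x y : Fin n → RMax => (x, y) ∈ W

/-- The kernel of a max-plus matrix: the set of the pairs `(x, y)` such that `E x = E y`. -/
def ker {p n : ℕ} (E : Matrix (Fin p) (Fin n) RMax) : Set ((Fin n → RMax) × (Fin n → RMax)) :=
  {z | E.mulVec z.1 = E.mulVec z.2}

end RMax

/-! Kernel to generators: an equation is two opposite inequalities, and a max-plus analogue of
Fourier–Motzkin elimination (`fg_inf_leSubmodule`) keeps a module finitely generated when one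
inequality is imposed. Generators to kernel: in exponential coordinates a finitely generated `W` is
closed. If `x` has finite coordinates, the `z` with `x ⊕ z` congruent to `x` form a closed lower set
determined coordinate by coordinate, hence the sublevel set of a linear form; since `W` is a
congruence, this form is constant on its classes (`IsCongruence.exists_linear_form`). Perturbing an
arbitrary `x` to finite coordinates and passing to the limit shows that such forms determine `W`.
They solve the finitely many equations given by generators of `W`, so the first half supplies
finitely many generating forms: the rows of `E`. -/

open scoped NNReal

/-! ### Passage to the nonnegative reals -/

namespace RMax

/-- The exponential, as a bijection from the max-plus semiring onto the nonnegative reals. -/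
noncomputable def expEquiv : RMax ≃ ℝ≥0 where
  toFun a := ((of.symm a).map fun r => (Real.exp r).toNNReal).unbotD 0
  invFun r := if r = 0 then 0 else of ((Real.log r : ℝ) : WithBot ℝ)
  left_inv a := by
    obtain ⟨b, rfl⟩ := of.surjective a
    induction b with
    | bot => simp [zero_eq]
    | coe r => simp [Real.exp_pos, (Real.exp_pos r).le]
  right_inv r := by
    by_cases h : r = 0
    · simp [h, zero_eq]
    · have : (0 : ℝ) < r := by positivity
      simp [h, Real.exp_log this]

theorem expEquiv_of_bot : expEquiv (of ⊥) = 0 := by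
  simp [expEquiv]

theorem coe_expEquiv_of_coe (r : ℝ) : (expEquiv (of r) : ℝ) = Real.exp r := by
  simp [expEquiv, (Real.exp_pos r).le]

@[simp]
theorem expEquiv_zero : expEquiv 0 = 0 := expEquiv_of_bot

@[simp]
theorem expEquiv_one : expEquiv 1 = 1 :=
  NNReal.eq (by rw [one_eq, coe_expEquiv_of_coe]; simp)

@[simp]
theorem expEquiv_add (a b : RMax) : expEquiv (a + b) = max (expEquiv a) (expEquiv b) := by
  obtain ⟨a, rfl⟩ := of.surjective a
  obtain ⟨b, rfl⟩ := of.surjective b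
  rw [of_add_of]
  induction a with
  | bot => simp [expEquiv_of_bot]
  | coe r =>
    induction b with
    | bot => simp [expEquiv_of_bot]
    | coe s =>
      apply NNReal.eq
      rw [NNReal.coe_max, ← WithBot.coe_max]
      simp only [coe_expEquiv_of_coe]
      exact Real.exp_monotone.map_max

@[simp]
theorem expEquiv_mul (a b : RMax) : expEquiv (a * b) = expEquiv a * expEquiv b := by
  obtain ⟨a, rfl⟩ := of.surjective a
  obtain ⟨b, rfl⟩ := of.surjective b
  rw [of_mul_of]
  induction a with
  | bot => simp [expEquiv_of_bot]
  | coe r =>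
    induction b with
    | bot => simp [expEquiv_of_bot]
    | coe s =>
      apply NNReal.eq
      rw [NNReal.coe_mul, ← WithBot.coe_add]
      simp only [coe_expEquiv_of_coe]
      exact Real.exp_add r s

@[simp]
theorem expEquiv_eq_zero {a : RMax} : expEquiv a = 0 ↔ a = 0 := by
  rw [← expEquiv_zero, expEquiv.apply_eq_iff_eq]

@[simp]
theorem expEquiv_symm_zero : expEquiv.symm 0 = 0 := by
  rw [Equiv.symm_apply_eq, expEquiv_zero]

theorem expEquiv_symm_max (r s : ℝ≥0) :
    expEquiv.symm (max r s) = expEquiv.symm r + expEquiv.symm s := by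
  rw [Equiv.symm_apply_eq]
  simp

theorem expEquiv_sum {ι : Type*} (s : Finset ι) (f : ι → RMax) :
    expEquiv (∑ i ∈ s, f i) = s.sup fun i => expEquiv (f i) := by
  classical
  induction s using Finset.induction_on with
  | empty => simp
  | insert a s ha ih => rw [Finset.sum_insert ha, Finset.sup_insert, expEquiv_add, ih]

theorem add_eq_right_iff {a b : RMax} : a + b = b ↔ expEquiv a ≤ expEquiv b := by
  rw [← expEquiv.apply_eq_iff_eq, expEquiv_add, max_eq_right_iff]

theorem exists_mul_eq_one {a : RMax} (ha : a ≠ 0) : ∃ b : RMax, a * b = 1 := by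
  refine ⟨expEquiv.symm (expEquiv a)⁻¹, expEquiv.injective ?_⟩
  have : expEquiv a ≠ 0 := by simpa using ha
  simp [this]

theorem sum_add_eq_right {M ι : Type*} [AddCommMonoid M] {s : Finset ι} {f : ι → M} {z : M}
    (h : ∀ i ∈ s, f i + z = z) : ∑ i ∈ s, f i + z = z := by
  classical
  induction s using Finset.induction_on with
  | empty => simp
  | insert a s ha ih =>
    rw [Finset.sum_insert ha, add_assoc, ih fun i hi => h i (Finset.mem_insert_of_mem hi),
      h a (Finset.mem_insert_self a s)]

/-! ### Idempotent order and elimination of inequalities -/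

section Module

variable {M : Type*} [AddCommMonoid M] [Module RMax M]

theorem add_self_eq (x : M) : x + x = x := by
  have h : (1 : RMax) + 1 = 1 := expEquiv.injective (by simp)
  rw [← one_smul RMax x, ← add_smul, h]

theorem smul_add_smul_eq_right {a b : RMax} (h : expEquiv a ≤ expEquiv b) (x : M) :
    a • x + b • x = b • x := by
  rw [← add_smul, add_eq_right_iff.2 h]

/-- A linear combination belongs to a submodule as soon as each of its terms lies below an element
of the submodule that lies below the combination. -/
theorem sum_mem_of_forall_exists_between {ι : Type*} {s : Finset ι} {f : ι → M}
    {N : Submodule RMax M}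
    (h : ∀ i ∈ s, ∃ w ∈ N, f i + w = w ∧ w + ∑ j ∈ s, f j = ∑ j ∈ s, f j) :
    ∑ i ∈ s, f i ∈ N := by
  choose! w hw hfw hwz using h
  have h1 : ∑ i ∈ s, w i + ∑ i ∈ s, f i = ∑ i ∈ s, f i := sum_add_eq_right hwz
  have h2 : ∑ i ∈ s, w i + ∑ i ∈ s, f i = ∑ i ∈ s, w i := by
    rw [add_comm, ← Finset.sum_add_distrib]
    exact Finset.sum_congr rfl hfw
  rw [← h1, h2]
  exact N.sum_mem hw

/-- The submodule of the solutions of the inequality `f z ≤ g z`. -/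
def leSubmodule (f g : M →ₗ[RMax] RMax) : Submodule RMax M where
  carrier := {z | expEquiv (f z) ≤ expEquiv (g z)}
  add_mem' {a b} ha hb := by
    simp only [Set.mem_ofPred_eq, map_add, expEquiv_add] at *
    exact max_le_max ha hb
  zero_mem' := by simp
  smul_mem' c x hx := by
    simp only [Set.mem_ofPred_eq, map_smul, smul_eq_mul, expEquiv_mul] at *
    gcongr

theorem mem_leSubmodule {f g : M →ₗ[RMax] RMax} {z : M} :
    z ∈ leSubmodule f g ↔ expEquiv (f z) ≤ expEquiv (g z) := Iff.rfl

/-- Generators satisfying the inequality are kept; each violating one is paired with each satisfying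
one, weighted so that the `g`-value of the latter makes up for the `f`-value of the former. -/
theorem fg_inf_leSubmodule {V : Submodule RMax M} (hV : V.FG) (f g : M →ₗ[RMax] RMax) :
    (V ⊓ leSubmodule f g).FG := by
  classical
  obtain ⟨k, v, rfl⟩ := Submodule.fg_iff_exists_fin_generating_family.1 hV
  let good : Set (Fin k) := {i | v i ∈ leSubmodule f g}
  let G : Set M := v '' good ∪
    (fun p : Fin k × Fin k => f (v p.2) • v p.1 + g (v p.1) • v p.2) '' (good ×ˢ goodᶜ)
  have hG : G.Finite := ((Set.toFinite _).image _).union ((Set.toFinite _).image _)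
  refine Submodule.fg_def.2 ⟨G, hG, le_antisymm (Submodule.span_le.2 ?_) ?_⟩
  · have hv : ∀ i, v i ∈ Submodule.span RMax (Set.range v) :=
      fun i => Submodule.subset_span ⟨i, rfl⟩
    rintro _ (⟨i, hi, rfl⟩ | ⟨⟨i, j⟩, ⟨hi, hj⟩, rfl⟩)
    · exact ⟨hv i, hi⟩
    · refine ⟨add_mem (Submodule.smul_mem _ _ (hv i)) (Submodule.smul_mem _ _ (hv j)), ?_⟩
      have hi' : expEquiv (f (v i)) ≤ expEquiv (g (v i)) := hi
      change expEquiv _ ≤ expEquiv _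
      simp only [map_add, map_smul, smul_eq_mul, expEquiv_add, expEquiv_mul]
      refine max_le (le_max_of_le_left ?_) (le_max_of_le_left ?_)
      · gcongr
      · rw [mul_comm]
  · rintro z ⟨hz, hfg⟩
    obtain ⟨c, rfl⟩ := (Submodule.mem_span_range_iff_exists_fun RMax).1 hz
    refine sum_mem_of_forall_exists_between fun j _ => ?_
    have hle : ∀ (a : RMax) (i : Fin k), expEquiv a ≤ expEquiv (c i) →
        a • v i + ∑ i, c i • v i = ∑ i, c i • v i := by
      intro a i h
      rw [← Finset.add_sum_erase _ _ (Finset.mem_univ i), ← add_assoc,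
        smul_add_smul_eq_right h]
    by_cases hj : j ∈ good
    · exact ⟨c j • v j, Submodule.smul_mem _ _ (Submodule.subset_span (Or.inl ⟨j, hj, rfl⟩)),
        add_self_eq _, hle _ _ le_rfl⟩
    by_cases hc : c j = 0
    · exact ⟨0, zero_mem _, by simp [hc], by simp⟩
    have hj' : expEquiv (g (v j)) < expEquiv (f (v j)) := not_le.1 hj
    have hcj : 0 < expEquiv (c j) := pos_iff_ne_zero.2 (by simpa using hc)
    rw [SetLike.mem_coe, mem_leSubmodule] at hfg
    simp only [map_sum, map_smul, smul_eq_mul, expEquiv_sum, expEquiv_mul] at hfg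
    -- A term attaining the maximum in `g z` dominates every `f`-term, including its own, so its
    -- generator is good.
    obtain ⟨i, -, hi⟩ := Finset.exists_mem_eq_sup Finset.univ ⟨j, Finset.mem_univ j⟩
      fun i => expEquiv (c i) * expEquiv (g (v i))
    rw [hi, Finset.sup_le_iff] at hfg
    have hij := hfg j (Finset.mem_univ j)
    have hpos : 0 < expEquiv (c i) * expEquiv (g (v i)) :=
      (mul_pos hcj (pos_of_gt hj')).trans_le hij
    have hci : 0 < expEquiv (c i) := pos_of_mul_pos_left hpos zero_le
    have hgi : 0 < expEquiv (g (v i)) := pos_of_mul_pos_right hpos zero_le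
    have hig : i ∈ good := le_of_mul_le_mul_left (hfg i (Finset.mem_univ i)) hci
    obtain ⟨b, hb⟩ := exists_mul_eq_one (a := g (v i)) (by simpa using hgi.ne')
    -- This scaling restores the coefficient `c j` of `v j`; `hij` keeps that of `v i` below `c i`.
    refine ⟨(c j * b) • (f (v j) • v i + g (v i) • v j), Submodule.smul_mem _ _
      (Submodule.subset_span (Or.inr ⟨(i, j), ⟨hig, hj⟩, rfl⟩)), ?_, ?_⟩
    all_goals
      have h1 : (c j * b) • (f (v j) • v i + g (v i) • v j)
          = (c j * b * f (v j)) • v i + c j • v j := by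
        rw [smul_add, smul_smul, smul_smul, mul_assoc (c j) b (g (v i)), mul_comm b, hb, mul_one]
      rw [h1]
    · rw [add_left_comm, add_self_eq]
    · rw [add_assoc, hle _ _ le_rfl, hle]
      refine le_of_mul_le_mul_right ?_ hgi
      have hb' : expEquiv b * expEquiv (g (v i)) = 1 := by
        rw [← expEquiv_mul, mul_comm, hb, expEquiv_one]
      calc expEquiv (c j * b * f (v j)) * expEquiv (g (v i))
          = expEquiv (c j) * expEquiv (f (v j)) * (expEquiv b * expEquiv (g (v i))) := by
            simp only [expEquiv_mul]; ring
        _ ≤ _ := by rw [hb', mul_one]; exact hij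

/-- The solution set of finitely many linear equations in a finitely generated module is finitely
generated. -/
theorem fg_iInf_eqLocus [Module.Finite RMax M] {ι : Type*} [Finite ι]
    (f g : ι → M →ₗ[RMax] RMax) : (⨅ i, LinearMap.eqLocus (f i) (g i)).FG := by
  classical
  have := Fintype.ofFinite ι
  suffices ∀ s : Finset ι, (⨅ i ∈ s, LinearMap.eqLocus (f i) (g i)).FG by
    simpa using this Finset.univ
  intro s
  induction s using Finset.induction_on with
  | empty => simpa using Module.Finite.fg_top
  | insert a s ha ih =>
    have h := fg_inf_leSubmodule (fg_inf_leSubmodule ih (f a) (g a)) (g a) (f a)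
    rw [inf_assoc] at h
    have h' : leSubmodule (f a) (g a) ⊓ leSubmodule (g a) (f a)
        = LinearMap.eqLocus (f a) (g a) := by
      ext z
      rw [Submodule.mem_inf, mem_leSubmodule, mem_leSubmodule, ← le_antisymm_iff,
        expEquiv.apply_eq_iff_eq, LinearMap.mem_eqLocus]
    rwa [h', inf_comm, ← Finset.iInf_insert a s fun i => LinearMap.eqLocus (f i) (g i)] at h

end Module

/-! ### Closedness of finitely generated submodules -/

/-- The membership in a finitely generated submodule, tested coordinate by coordinate. -/
theorem mem_span_range_iff {ι κ : Type*} [Fintype ι] [Fintype κ] (v : κ → ι → RMax)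
    (z : ι → RMax) :
    z ∈ Submodule.span RMax (Set.range v) ↔ ∀ c, expEquiv (z c) = 0 ∨ ∃ i, v i c ≠ 0 ∧
      ∀ d, expEquiv (v i d) * expEquiv (z c) ≤ expEquiv (v i c) * expEquiv (z d) := by
  classical
  constructor
  · intro hz c
    obtain ⟨a, rfl⟩ := (Submodule.mem_span_range_iff_exists_fun RMax).1 hz
    have hval : ∀ d, expEquiv ((∑ i, a i • v i) d)
        = Finset.univ.sup fun i => expEquiv (a i) * expEquiv (v i d) := by
      intro d
      simp [Finset.sum_apply, expEquiv_sum]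
    rw [or_iff_not_imp_left]
    intro h0
    have hne : (Finset.univ : Finset κ).Nonempty := by
      by_contra h
      rw [Finset.not_nonempty_iff_eq_empty] at h
      rw [hval, h] at h0
      simp at h0
    obtain ⟨i, -, hi⟩ := Finset.exists_mem_eq_sup Finset.univ hne
      fun i => expEquiv (a i) * expEquiv (v i c)
    rw [hval, hi] at h0
    refine ⟨i, fun h => h0 (by simp [h]), fun d => ?_⟩
    rw [hval c, hi, hval d, mul_left_comm, mul_comm (expEquiv (v i d)), mul_left_comm]
    gcongr
    exact Finset.le_sup (f := fun i => expEquiv (a i) * expEquiv (v i d)) (Finset.mem_univ i)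
  · intro h
    rw [← Finset.univ_sum_single z]
    refine sum_mem_of_forall_exists_between fun c _ => ?_
    rw [Finset.univ_sum_single]
    rcases h c with h0 | ⟨i, hi, hle⟩
    · exact ⟨0, zero_mem _, by simp [expEquiv_eq_zero.1 h0], by simp⟩
    obtain ⟨b, hb⟩ := exists_mul_eq_one hi
    -- The multiple of `v i` that agrees with `z` at `c`; `hle` places it below `z`.
    refine ⟨(z c * b) • v i, Submodule.smul_mem _ _ (Submodule.subset_span ⟨i, rfl⟩), ?_, ?_⟩
    · ext d
      rw [Pi.add_apply, add_eq_right_iff]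
      by_cases hd : d = c
      · subst hd
        rw [Pi.single_eq_same, Pi.smul_apply, smul_eq_mul, mul_assoc, mul_comm b, hb, mul_one]
      · simp [hd]
    · ext d
      rw [Pi.add_apply, add_eq_right_iff, Pi.smul_apply, smul_eq_mul]
      have hpos : 0 < expEquiv (v i c) := pos_iff_ne_zero.2 (by simpa using hi)
      refine le_of_mul_le_mul_left ?_ hpos
      have hb' : expEquiv (v i c) * expEquiv b = 1 := by
        rw [← expEquiv_mul, hb, expEquiv_one]
      calc expEquiv (v i c) * expEquiv (z c * b * v i d)
          = expEquiv (v i c) * expEquiv b * (expEquiv (v i d) * expEquiv (z c)) := by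
            simp only [expEquiv_mul]; ring
        _ ≤ _ := by rw [hb', one_mul]; exact hle d

/-- The criterion `mem_span_range_iff` involves no unknown coefficients, only finite unions and
intersections of closed conditions. -/
theorem isClosed_of_fg {ι : Type*} [Finite ι] {V : Submodule RMax (ι → RMax)} (hV : V.FG) :
    IsClosed {u : ι → ℝ≥0 | (fun i => expEquiv.symm (u i)) ∈ V} := by
  have := Fintype.ofFinite ι
  obtain ⟨k, v, rfl⟩ := Submodule.fg_iff_exists_fin_generating_family.1 hV
  simp only [mem_span_range_iff, Equiv.apply_symm_apply, Set.ofPred_forall, Set.ofPred_or,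
    Set.ofPred_exists, Set.ofPred_and]
  refine isClosed_iInter fun c => (isClosed_eq (by fun_prop) (by fun_prop)).union
    (isClosed_iUnion_of_finite fun i => .inter ?_ (isClosed_iInter fun d => ?_))
  · exact isClosed_iInter fun _ => isClosed_const
  · exact isClosed_le (by fun_prop) (by fun_prop)

theorem isClosed_prod_of_fg {ι κ : Type*} [Finite ι] [Finite κ]
    {W : Submodule RMax ((ι → RMax) × (κ → RMax))} (hW : W.FG) :
    IsClosed {u : (ι → ℝ≥0) × (κ → ℝ≥0) |
      ((fun i => expEquiv.symm (u.1 i)), fun i => expEquiv.symm (u.2 i)) ∈ W} := by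
  let e := LinearEquiv.sumArrowLequivProdArrow ι κ RMax RMax
  have h := isClosed_of_fg (hW.map (e.symm : _ →ₗ[RMax] (ι ⊕ κ → RMax)))
  have hc : Continuous fun u : (ι → ℝ≥0) × (κ → ℝ≥0) => Sum.elim u.1 u.2 := by
    refine continuous_pi fun i => ?_
    cases i <;> simp <;> fun_prop
  convert h.preimage hc using 1
  ext u
  simp only [Set.mem_ofPred_eq, Set.mem_preimage]
  rw [Submodule.mem_map_equiv]
  rfl

/-- A closed lower set of nonnegative reals that is not reduced to `0` is the solution set of an
inequality `a * r ≤ 1`. -/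
theorem exists_forall_mem_iff_mul_le_one {S : Set ℝ≥0} (hS : IsClosed S) (hlow : IsLowerSet S)
    {r : ℝ≥0} (hr : 0 < r) (hrS : r ∈ S) : ∃ a : ℝ≥0, ∀ s, s ∈ S ↔ a * s ≤ 1 := by
  by_cases hb : BddAbove S
  · have hpos : 0 < sSup S := hr.trans_le (le_csSup hb hrS)
    refine ⟨(sSup S)⁻¹, fun s => ?_⟩
    rw [inv_mul_le_iff₀ hpos, mul_one]
    exact ⟨fun hs => le_csSup hb hs, fun hs => hlow hs (hS.csSup_mem ⟨r, hrS⟩ hb)⟩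
  · refine ⟨0, fun s => ?_⟩
    obtain ⟨t, ht, hst⟩ := not_bddAbove_iff.1 hb s
    simp [hlow hst.le ht]

theorem eq_of_forall_mul_le_one_iff {a b : ℝ≥0}
    (h : ∀ c : ℝ≥0, c ≠ 0 → (c * a ≤ 1 ↔ c * b ≤ 1)) : a = b := by
  suffices ∀ a b : ℝ≥0, (∀ c : ℝ≥0, c ≠ 0 → (c * a ≤ 1 → c * b ≤ 1)) → b ≤ a from
    le_antisymm (this b a fun c hc => (h c hc).2) (this a b fun c hc => (h c hc).1)
  intro a b h
  refine le_of_forall_gt_imp_ge_of_dense fun c hc => ?_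
  have hpos : 0 < c := pos_of_gt hc
  have := h c⁻¹ (inv_ne_zero hpos.ne') (by rw [inv_mul_le_iff₀ hpos, mul_one]; exact hc.le)
  rwa [inv_mul_le_iff₀ hpos, mul_one] at this

/-! ### Separation by linear forms -/

section Separation

variable {n : ℕ} {W : Submodule RMax ((Fin n → RMax) × (Fin n → RMax))}

theorem IsCongruence.add_right_mem (hW : IsCongruence W) {x y : Fin n → RMax} (h : (x, y) ∈ W)
    (z : Fin n → RMax) : (x + z, y + z) ∈ W :=
  W.add_mem h (hW.refl z)

/-- The elements `z` such that `x ⊕ z` is congruent to `x` form a lower set. -/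
theorem IsCongruence.absorb_mono (hW : IsCongruence W) {x z w : Fin n → RMax}
    (h : (x + z, x) ∈ W) (hwz : w + z = z) : (x + w, x) ∈ W := by
  have h1 := hW.add_right_mem h w
  rw [add_assoc, add_comm z, hwz] at h1
  exact hW.trans (hW.symm h1) h

theorem IsCongruence.absorb_iff (hW : IsCongruence W) {x z : Fin n → RMax} :
    (x + z, x) ∈ W ↔ ∀ i, (x + Pi.single i (z i), x) ∈ W := by
  classical
  constructor
  · intro h i
    refine hW.absorb_mono h ?_
    ext j
    rw [Pi.add_apply, add_eq_right_iff]
    by_cases hj : j = i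
    · subst hj; simp
    · simp [hj]
  · intro h
    suffices ∀ s : Finset (Fin n), (x + ∑ i ∈ s, Pi.single i (z i), x) ∈ W by
      simpa [Finset.univ_sum_single] using this Finset.univ
    intro s
    induction s using Finset.induction_on with
    | empty => simpa using hW.refl x
    | insert a s ha ih =>
      have := W.add_mem (h a) ih
      rwa [Prod.mk_add_mk, add_add_add_comm, add_self_eq, 
          ← Finset.sum_insert (f := fun i => Pi.single i (z i)) ha] at this

/-- If all the coordinates of `x` are finite, there is a linear form that is constant on the
classes of the congruence and for which the elements `z` such that `x ⊕ z` is congruent to `x` are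
those at which the form is at most the unit. -/
theorem IsCongruence.exists_linear_form (hW : IsCongruence W) (hfg : W.FG) {x : Fin n → RMax}
    (hx : ∀ i, x i ≠ 0) : ∃ e : Fin n → RMax, (∀ u ∈ W, e ⬝ᵥ u.1 = e ⬝ᵥ u.2) ∧
      ∀ z, (x + z, x) ∈ W ↔ expEquiv (e ⬝ᵥ z) ≤ 1 := by
  classical
  have hclosed := isClosed_prod_of_fg hfg
  have hex : ∀ i, ∃ a : ℝ≥0, ∀ r : ℝ≥0,
      (x + Pi.single i (expEquiv.symm r), x) ∈ W ↔ a * r ≤ 1 := by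
    intro i
    let S : Set ℝ≥0 := {r | (x + Pi.single i (expEquiv.symm r), x) ∈ W}
    have hS : IsClosed S := by
      have hc : Continuous fun r : ℝ≥0 =>
          ((fun j => max (expEquiv (x j)) ((Pi.single i r : Fin n → ℝ≥0) j) : Fin n → ℝ≥0),
            fun j => expEquiv (x j)) := by
        refine .prodMk (continuous_pi fun j => continuous_const.max ?_) continuous_const
        by_cases hj : j = i
        · subst hj; simpa using continuous_id'
        · simpa [hj] using continuous_const
      convert hclosed.preimage hc using 1
      ext r
      simp only [S, Set.mem_ofPred_eq, Set.mem_preimage, Equiv.symm_apply_apply,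
        expEquiv_symm_max]
      convert Iff.rfl using 3
      ext j
      by_cases hj : j = i
      · subst hj; simp
      · simp [hj]
    -- Finiteness of `x i` excludes `S = {0}`, which would require an infinite coefficient.
    refine exists_forall_mem_iff_mul_le_one hS (fun r s hsr hr => ?_)
      (r := expEquiv (x i)) (pos_iff_ne_zero.2 (by simpa using hx i)) ?_
    · refine hW.absorb_mono hr ?_
      rw [← Pi.single_add, add_eq_right_iff.2 (by simpa using hsr)]
    · change (x + Pi.single i (expEquiv.symm (expEquiv (x i))), x) ∈ W
      rw [Equiv.symm_apply_apply]
      exact hW.absorb_iff.1 (by rw [add_self_eq]; exact hW.refl x) i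
  choose a ha using hex
  have hiff : ∀ z, (x + z, x) ∈ W ↔ expEquiv ((fun i => expEquiv.symm (a i)) ⬝ᵥ z) ≤ 1 := by
    intro z
    rw [hW.absorb_iff]
    simp only [dotProduct, expEquiv_sum, expEquiv_mul, Equiv.apply_symm_apply, Finset.sup_le_iff,
      Finset.mem_univ, true_imp_iff, ← ha, Equiv.symm_apply_apply]
  -- Rescaling turns the single sublevel set into all of them, and transitivity shows that `u.1` and
  -- `u.2` lie in the same ones.
  refine ⟨_, fun u hu => expEquiv.injective (eq_of_forall_mul_le_one_iff fun c _ => ?_), hiff⟩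
  have key : ∀ z : Fin n → RMax, c * expEquiv ((fun i => expEquiv.symm (a i)) ⬝ᵥ z) ≤ 1 ↔
      (x + expEquiv.symm c • z, x) ∈ W := by
    intro z
    rw [hiff, dotProduct_smul, smul_eq_mul, expEquiv_mul, Equiv.apply_symm_apply]
  rw [key, key]
  have hcu : (x + expEquiv.symm c • u.1, x + expEquiv.symm c • u.2) ∈ W :=
    W.add_mem (hW.refl x) (W.smul_mem (expEquiv.symm c) hu)
  exact ⟨fun h => hW.trans (hW.symm hcu) h, fun h => hW.trans hcu h⟩

theorem IsCongruence.add_mem_of_forall_dotProduct_eq (hW : IsCongruence W) (hfg : W.FG)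
    {x y : Fin n → RMax}
    (h : ∀ e : Fin n → RMax, (∀ u ∈ W, e ⬝ᵥ u.1 = e ⬝ᵥ u.2) → e ⬝ᵥ x = e ⬝ᵥ y) :
    (x + y, x) ∈ W := by
  -- Adding the constant vector `t` makes all coordinates finite; closedness of `W` then allows `t`
  -- to tend to `0`, that is, to `-∞` in `RMax`.
  have hpos : ∀ t : ℝ≥0, 0 < t →
      (x + (fun _ => expEquiv.symm t) + y, x + fun _ => expEquiv.symm t) ∈ W := by
    intro t ht
    obtain ⟨e, he, hiff⟩ := hW.exists_linear_form hfg (x := x + fun _ => expEquiv.symm t) (by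
      intro i hi
      rw [← expEquiv_eq_zero] at hi
      simp at hi
      exact ht.ne' hi.2)
    rw [hiff, ← h e he, ← hiff, add_right_comm, add_self_eq]
    exact hW.refl _
  have hc : Continuous fun t : ℝ≥0 =>
      ((fun i => max (max (expEquiv (x i)) t) (expEquiv (y i)) : Fin n → ℝ≥0),
        (fun i => max (expEquiv (x i)) t : Fin n → ℝ≥0)) := by fun_prop
  have hcl := (isClosed_prod_of_fg hfg).preimage hc
  have h0 : (0 : ℝ≥0) ∈ closure (Set.Ioi 0) := by
    rw [closure_Ioi]; exact Set.self_mem_Ici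
  have hmem := hcl.closure_subset_iff.2 (fun t ht => by
    simp only [Set.mem_preimage, Set.mem_ofPred_eq, expEquiv_symm_max, Equiv.symm_apply_apply]
    exact hpos t ht) h0
  simp only [Set.mem_preimage, Set.mem_ofPred_eq, expEquiv_symm_max, Equiv.symm_apply_apply,
    expEquiv_symm_zero, add_zero] at hmem
  exact hmem

/-- A finitely generated congruence is determined by the linear forms that are constant on its
classes. -/
theorem IsCongruence.mem_iff_forall_dotProduct_eq (hW : IsCongruence W) (hfg : W.FG)
    {x y : Fin n → RMax} : (x, y) ∈ W ↔
      ∀ e : Fin n → RMax, (∀ u ∈ W, e ⬝ᵥ u.1 = e ⬝ᵥ u.2) → e ⬝ᵥ x = e ⬝ᵥ y := by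
  refine ⟨fun h e he => he _ h, fun h => ?_⟩
  have h1 := hW.add_mem_of_forall_dotProduct_eq hfg h
  have h2 := hW.add_mem_of_forall_dotProduct_eq hfg fun e he => (h e he).symm
  rw [add_comm] at h2
  exact hW.trans (hW.symm h1) h2

end Separation

/-! ### The two implications -/

theorem fg_of_eq_ker {p n : ℕ} {W : Submodule RMax ((Fin n → RMax) × (Fin n → RMax))}
    {E : Matrix (Fin p) (Fin n) RMax}
    (h : (W : Set ((Fin n → RMax) × (Fin n → RMax))) = ker E) : W.FG := by
  let f : Fin p → (Fin n → RMax) →ₗ[RMax] RMax := fun i => LinearMap.proj i ∘ₗ E.mulVecLin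
  have hfg := fg_iInf_eqLocus (M := (Fin n → RMax) × (Fin n → RMax))
    (fun i => f i ∘ₗ LinearMap.fst RMax _ _) (fun i => f i ∘ₗ LinearMap.snd RMax _ _)
  convert hfg
  ext z
  rw [← SetLike.mem_coe, h]
  simp [ker, f, Submodule.mem_iInf, funext_iff]

/-- Each generator of `W` imposes one linear equation on `e`, so `fg_iInf_eqLocus` applies on the
dual side. -/
theorem exists_fg_annihilator {n : ℕ} {W : Submodule RMax ((Fin n → RMax) × (Fin n → RMax))}
    (hfg : W.FG) : ∃ N : Submodule RMax (Fin n → RMax), N.FG ∧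
      ∀ e, e ∈ N ↔ ∀ u ∈ W, e ⬝ᵥ u.1 = e ⬝ᵥ u.2 := by
  obtain ⟨k, v, rfl⟩ := Submodule.fg_iff_exists_fin_generating_family.1 hfg
  let f : (Fin n → RMax) → (Fin n → RMax) →ₗ[RMax] RMax := fun x =>
    ∑ i, x i • LinearMap.proj i
  have hf : ∀ x e, f x e = e ⬝ᵥ x := by
    intro x e
    simp [f, dotProduct, mul_comm]
  refine ⟨_, fg_iInf_eqLocus (fun i => f (v i).1) (fun i => f (v i).2), fun e => ?_⟩
  simp only [Submodule.mem_iInf, LinearMap.mem_eqLocus, hf]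
  refine ⟨fun h u hu => ?_, fun h i => h _ (Submodule.subset_span ⟨i, rfl⟩)⟩
  induction hu using Submodule.span_induction with
  | mem u hu =>
    obtain ⟨i, rfl⟩ := hu
    exact h i
  | zero => simp
  | add u w _ _ hu hw => simp [dotProduct_add, hu, hw]
  | smul c u _ hu => simp [dotProduct_smul, hu]

theorem IsCongruence.exists_eq_ker {n : ℕ}
    {W : Submodule RMax ((Fin n → RMax) × (Fin n → RMax))} (hW : IsCongruence W) (hfg : W.FG) :
    ∃ (p : ℕ) (E : Matrix (Fin p) (Fin n) RMax),
      (W : Set ((Fin n → RMax) × (Fin n → RMax))) = ker E := by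
  obtain ⟨N, hN, hmem⟩ := exists_fg_annihilator hfg
  obtain ⟨p, E, rfl⟩ := Submodule.fg_iff_exists_fin_generating_family.1 hN
  refine ⟨p, Matrix.of E, ?_⟩
  ext ⟨x, y⟩
  rw [SetLike.mem_coe, hW.mem_iff_forall_dotProduct_eq hfg]
  simp only [← hmem, ker, Set.mem_ofPred_eq, funext_iff]
  refine ⟨fun h i => h _ (Submodule.subset_span ⟨i, rfl⟩), fun h e he => ?_⟩
  induction he using Submodule.span_induction with
  | mem e he =>
    obtain ⟨i, rfl⟩ := he
    exact h i
  | zero => simp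
  | add d e _ _ hd he => simp [add_dotProduct, hd, he]
  | smul c e _ he => simp [smul_dotProduct, he]

end RMax

theorem lemma4p7 (n : ℕ) (W : Submodule RMax ((Fin n → RMax) × (Fin n → RMax)))
    (hW : RMax.IsCongruence W) :
    (∃ (p : ℕ) (E : Matrix (Fin p) (Fin n) RMax),
      (W : Set ((Fin n → RMax) × (Fin n → RMax))) = RMax.ker E) ↔ W.FG :=
  ⟨fun ⟨_, _, h⟩ => RMax.fg_of_eq_ker h, hW.exists_eq_ker⟩
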